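/- A finite sequence $u$ contains a finite sequence $v$ if some (not necessarily contiguous) subsequence of $u$ is isomorphic to $v$, i.e. becomes $v$ under a one-to-one renaming of letters; otherwise $u$ avoids $v$. For a sequence $u$ with $r$ distinct letters, let $\mathrm{Ex}(u,n)$ be the maximum length of a sequence over an alphabet of $n$ letters that avoids $u$ and in which every $r$ consecutive letters are distinct. (If $u$ is the empty sequence, which nothing avoids, put $\mathrm{Ex}(u,n)=0$.) Call $u$ minimally non-linear if $\mathrm{Ex}(u,n)=\omega(n)$ but $\mathrm{Ex}(u',n)=O(n)$ for every $u'$ contained in $u$ and not isomorphic to $u$. Corollary. For every $k \ge 0$, the number of minimally non-linear sequences with exactly $k$ distinct letters, taken from a fixed alphabet of $k$ letters, is finite and at most $$2k\sum_{i=1}^{\mathrm{Ex}(ababa,\,k)}(2k-2)^{i-1}.$$ Here $0^0=1$. -/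

import Mathlib

/-- Two finite sequences (over possibly different alphabets) are isomorphic if one arises from the
other by a one-to-one renaming of its letters: they have the same length and the same pattern of
equalities between positions. -/
def SeqIso {α β : Type*} (u : List α) (v : List β) : Prop :=
  u.length = v.length ∧ ∀ i j : ℕ, u[i]? = u[j]? ↔ v[i]? = v[j]?

/-- `u` contains `v` if some (not necessarily contiguous) subsequence of `u` is isomorphic
to `v`. -/
def SeqContains {α β : Type*} (u : List α) (v : List β) : Prop :=
  ∃ w : List α, w.Sublist u ∧ SeqIso w v

/-- The number of distinct letters of a sequence. -/
def numLetters {α : Type*} [DecidableEq α] (u : List α) : ℕ :=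
  u.toFinset.card

/-- Every `r` consecutive letters of `v` are distinct. -/
def IsSparse {α : Type*} (r : ℕ) (v : List α) : Prop :=
  ∀ w : List α, w <:+: v → w.length = r → w.Nodup

/-- The lengths of the sequences over an alphabet of `n` letters that avoid `u` and in which every
`r` consecutive letters are distinct, where `r` is the number of distinct letters of `u`. -/
def exLengths {α : Type*} [DecidableEq α] (u : List α) (n : ℕ) : Set ℕ :=
  {l | ∃ v : List (Fin n), v.length = l ∧ ¬ SeqContains v u ∧ IsSparse (numLetters u) v}

/-- The extremal function `Ex(u, n)`. For nonempty `u` it is a genuine maximum,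
see `Ex_isGreatest`; for the empty sequence, which nothing avoids, it is `0`. -/
noncomputable def Ex {α : Type*} [DecidableEq α] (u : List α) (n : ℕ) : ℕ :=
  sSup (exLengths u n)

/-- `u` is minimally non-linear: `Ex(u, n) = ω(n)`, and `Ex(u', n) = O(n)` for every `u'` that is
strictly contained in `u` (contained in `u`, and not isomorphic to `u`). As isomorphic
sequences have the same extremal function, it is enough to let `u'` range over sequences in the
alphabet of `u`. -/
def MinimallyNonlinear {α : Type*} [DecidableEq α] (u : List α) : Prop :=
  (fun n : ℕ => (n : ℝ)) =o[Filter.atTop] (fun n : ℕ => (Ex u n : ℝ)) ∧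
  ∀ u' : List α, SeqContains u u' → ¬ SeqIso u' u →
    (fun n : ℕ => (Ex u' n : ℝ)) =O[Filter.atTop] (fun n : ℕ => (n : ℝ))

/-- The sequence `ababa`. -/
def ababa : List (Fin 2) := [0, 1, 0, 1, 0]

/-- Long enough sparse sequences over a finite alphabet contain `u`. -/
theorem exLengths_bddAbove {α : Type*} [DecidableEq α] (u : List α) (hu : u ≠ []) (n : ℕ) :
    BddAbove (exLengths u n) := by
  classical
  set r := numLetters u with hr
  have hr0 : 0 < r := by
    rw [hr, numLetters, Finset.card_pos]
    obtain ⟨x, hx⟩ := List.exists_mem_of_ne_nil u hu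
    exact ⟨x, by simpa using hx⟩
  refine ⟨r * (n ^ r * u.length + 1), ?_⟩
  rintro l ⟨v, rfl, hav, hsp⟩
  by_contra! hlen
  apply hav
  set M := n ^ r * u.length + 1 with hM
  have hpos : ∀ (m : Fin M) (i : Fin r), r * m + i < v.length := by
    intro m i
    have h1 : r * (m : ℕ) + r ≤ r * M := by
      have := Nat.mul_le_mul_left r (Nat.succ_le_of_lt m.2)
      simpa [Nat.mul_succ] using this
    have := i.2
    omega
  let t : Fin M → (Fin r → Fin n) := fun m i => v[r * m + i]'(hpos m i)
  have hne : Nonempty (Fin r → Fin n) := ⟨t ⟨0, by omega⟩⟩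
  obtain ⟨f, hf⟩ := Fintype.exists_le_card_fiber_of_mul_le_card (n := u.length) t (by
    simp [hM])
  obtain ⟨S, hS, hScard⟩ := Finset.exists_subset_card_eq hf
  let e := S.orderEmbOfFin hScard
  have he : ∀ j, t (e j) = f := fun j => by
    have := hS (Finset.orderEmbOfFin_mem S hScard j)
    simpa using this
  let c : u.toFinset ≃ Fin r := u.toFinset.equivFin
  let d : Fin u.length → Fin r := fun j => c ⟨u[j], by simp⟩
  have hd : ∀ i j, d i = d j ↔ u[i] = u[j] := by
    intro i j
    simp [d]
  have hf_inj : Function.Injective f := by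
    have hL : 0 < u.length := List.length_pos_of_ne_nil hu
    have h0 := he ⟨0, hL⟩
    set m := e ⟨0, hL⟩
    have hw := hsp ((v.drop (r * m)).take r)
      ((List.take_prefix _ _).isInfix.trans (List.drop_suffix _ _).isInfix) (by
        have := hpos m ⟨r - 1, by omega⟩
        simp only [List.length_take, List.length_drop]
        simp only at this
        omega)
    intro i j hij
    rw [← h0] at hij
    have := hpos m i
    have := hpos m j
    have := i.2
    have := j.2
    have key := (List.Nodup.getElem_inj_iff hw (i := i) (j := j)
      (hi := by simp only [List.length_take, List.length_drop]; omega)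
      (hj := by simp only [List.length_take, List.length_drop]; omega)).1 (by
        simpa [t] using hij)
    exact Fin.ext key
  let p : Fin u.length → Fin v.length := fun j => ⟨r * e j + d j, hpos _ _⟩
  have hp : StrictMono p := by
    intro i j hij
    have h1 : (e i : ℕ) < e j := (e.strictMono hij)
    have h2 : r * (e i : ℕ) + r ≤ r * e j := by
      simpa [Nat.mul_succ] using Nat.mul_le_mul_left r (Nat.succ_le_of_lt h1)
    have := (d i).2
    change r * (e i : ℕ) + d i < r * (e j : ℕ) + d j
    omega
  have hval : ∀ j, v[p j] = f (d j) := fun j => by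
    rw [← he j]
    rfl
  refine ⟨List.ofFn (fun j => v[p j]), ?_, by simp, ?_⟩
  · rw [List.sublist_iff_exists_fin_orderEmbedding_get_eq]
    refine ⟨(Fin.castOrderIso (by simp)).toOrderEmbedding.trans
      (OrderEmbedding.ofStrictMono p hp), ?_⟩
    intro ix
    simp
    rfl
  · intro i j
    simp only [List.getElem?_ofFn, hval]
    by_cases hi : i < u.length <;> by_cases hj : j < u.length <;>
      simp [hi, hj, hf_inj.eq_iff, hd]

/-- For nonempty `u`, the value `Ex(u, n)` is the maximum of the lengths in question. -/
theorem Ex_isGreatest {α : Type*} [DecidableEq α] (u : List α) (hu : u ≠ []) (n : ℕ) :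
    IsGreatest (exLengths u n) (Ex u n) := by
  have hb := exLengths_bddAbove u hu n
  refine ⟨Nat.sSup_mem ⟨0, [], rfl, ?_, ?_⟩ hb, fun l hl => le_csSup hb hl⟩
  · rintro ⟨w, hw, hiso⟩
    rw [List.sublist_nil.1 hw] at hiso
    exact hu (List.length_eq_zero_iff.1 hiso.1.symm)
  · intro w hw _
    rw [List.infix_nil.1 hw]
    exact List.nodup_nil

/-! Two facts restrict a minimally non-linear `u`. First, `u` has no factor `aaa`: shortening it to
`aa` changes the extremal function by at most a constant factor and an additive constant
(`Ex_triple_le`), and the shorter sequence has linear extremal function by minimality. Second, `Ex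
ababa` is not O(n) (`not_isBigO_Ex_ababa`), so `u` can contain `ababa` only by being isomorphic to
it. If `u` avoids `ababa`, one letter from each run gives a sequence over `k` letters without
repetitions `aa` that still avoids `ababa`, so there are at most `Ex ababa k` runs, each of length
one or two. With `i` runs there are `2k` choices for the first run and at most `2k - 2` for each
later one, which gives the bound. The copies of `ababa` matter only for `k = 2`; there they are paid
for by the one-run sequences, which use too few letters. Superlinearity comes from a recursive
construction. A sequence is cut into fans, blocks of first occurrences. Given `T` with fans of size
`m` and `S` with fans of size `T.length`, each fan of `S` is replaced by a fresh copy of `T`, and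
its letters are distributed over the ends of the fans of that copy. The result has fans of size `m +
1` and no new `ababa` (`IsProper.avoids_compose`). Iteration makes the ratio of length to number of
letters unbounded (`exists_isProper`). The reduction from `aaa` to `aa` rests on a greedy
subsequence (`exists_thinning`). -/

/-! ### Isomorphism and containment of sequences. -/

theorem SeqIso.refl {α : Type*} (u : List α) : SeqIso u u := ⟨rfl, fun _ _ => Iff.rfl⟩

theorem SeqIso.symm {α β : Type*} {u : List α} {v : List β} (h : SeqIso u v) : SeqIso v u :=
  ⟨h.1.symm, fun i j => (h.2 i j).symm⟩

theorem SeqIso.trans {α β γ : Type*} {u : List α} {v : List β} {w : List γ}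
    (h : SeqIso u v) (h' : SeqIso v w) : SeqIso u w :=
  ⟨h.1.trans h'.1, fun i j => (h.2 i j).trans (h'.2 i j)⟩

theorem SeqIso.of_map {α β : Type*} {u : List α} {f : α → β}
    (hf : ∀ x ∈ u, ∀ y ∈ u, f x = f y → x = y) : SeqIso u (u.map f) := by
  refine ⟨by simp, fun i j => ?_⟩
  simp only [List.getElem?_map]
  constructor
  · intro h; rw [h]
  · intro h
    cases hi : u[i]? <;> cases hj : u[j]? <;> simp_all
    exact hf _ (List.mem_of_getElem? hi) _ (List.mem_of_getElem? hj) h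

/-- A letter goes to the entry of `v` at its first position in `u`. Nonemptiness of `u` provides a
default value for the letters outside `u`; without it `β` could be empty. -/
theorem SeqIso.exists_map {α β : Type*} {u : List α} {v : List β} (hu : u ≠ [])
    (h : SeqIso u v) :
    ∃ f : α → β, (∀ x ∈ u, ∀ y ∈ u, f x = f y → x = y) ∧ v = u.map f := by
  classical
  have hv : v ≠ [] := by
    rintro rfl
    exact hu (List.length_eq_zero_iff.1 h.1)
  obtain ⟨b, hb⟩ := List.exists_mem_of_ne_nil v hv
  have key : ∀ i (hi : i < u.length), (v[u.idxOf u[i]]?).getD b = v[i]'(h.1 ▸ hi) := by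
    intro i hi
    have hm : u[i] ∈ u := List.getElem_mem hi
    have hlt : u.idxOf u[i] < u.length := List.idxOf_lt_length_iff.2 hm
    have h1 : u[u.idxOf u[i]]? = u[i]? := by
      rw [List.getElem?_eq_getElem hlt, List.getElem?_eq_getElem hi, List.getElem_idxOf hlt]
    rw [(h.2 _ _).1 h1, List.getElem?_eq_getElem (h.1 ▸ hi)]
    rfl
  refine ⟨fun x => (v[u.idxOf x]?).getD b, ?_, ?_⟩
  · intro x hx y hy hxy
    obtain ⟨i, hi, rfl⟩ := List.getElem_of_mem hx
    obtain ⟨j, hj, rfl⟩ := List.getElem_of_mem hy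
    simp only [key i hi, key j hj] at hxy
    have := (h.2 i j).2 (by
      rw [List.getElem?_eq_getElem (h.1 ▸ hi), List.getElem?_eq_getElem (h.1 ▸ hj), hxy])
    rw [List.getElem?_eq_getElem hi, List.getElem?_eq_getElem hj] at this
    exact Option.some.inj this
  · apply List.ext_getElem
    · simp [h.1]
    · intro i h1 h2
      simp only [List.getElem_map]
      exact (key i (by simpa using h2)).symm

theorem SeqIso.numLetters_eq {α β : Type*} [DecidableEq α] [DecidableEq β] {u : List α}
    {v : List β} (h : SeqIso u v) : numLetters u = numLetters v := by
  by_cases hu : u = []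
  · subst hu
    rw [List.length_eq_zero_iff.1 h.1.symm]
    rfl
  · obtain ⟨f, hf, rfl⟩ := h.exists_map hu
    have : (u.map f).toFinset = u.toFinset.image f := by ext; simp
    rw [numLetters, numLetters, this, Finset.card_image_of_injOn]
    intro x hx y hy hxy
    exact hf x (by simpa using hx) y (by simpa using hy) hxy

theorem SeqIso.Ex_eq {α β : Type*} [DecidableEq α] [DecidableEq β] {u : List α}
    {v : List β} (h : SeqIso u v) (n : ℕ) : Ex u n = Ex v n := by
  have hc : ∀ z : List (Fin n), SeqContains z u ↔ SeqContains z v := fun z =>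
    ⟨fun ⟨w, hw, hi⟩ => ⟨w, hw, hi.trans h⟩, fun ⟨w, hw, hi⟩ => ⟨w, hw, hi.trans h.symm⟩⟩
  simp only [Ex, exLengths, hc, h.numLetters_eq]

theorem SeqContains.of_sublist {α β : Type*} {u u' : List α} {v : List β}
    (h : SeqContains u' v) (hs : u'.Sublist u) : SeqContains u v :=
  let ⟨w, hw, hi⟩ := h
  ⟨w, hw.trans hs, hi⟩

theorem length_le_Ex {α : Type*} [DecidableEq α] {u : List α} (hu : u ≠ []) {n : ℕ}
    {v : List (Fin n)} (hav : ¬ SeqContains v u) (hsp : IsSparse (numLetters u) v) :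
    v.length ≤ Ex u n :=
  le_csSup (exLengths_bddAbove u hu n) ⟨v, rfl, hav, hsp⟩

theorem isSparse_two_of_isChain {α : Type*} {v : List α} (h : v.IsChain (· ≠ ·)) :
    IsSparse 2 v := by
  intro w hw hl
  have := h.infix hw
  obtain ⟨a, b, rfl⟩ := List.length_eq_two.1 hl
  simpa using this

theorem seqContains_ababa_iff {α : Type*} {v : List α} :
    SeqContains v ababa ↔ ∃ x y, x ≠ y ∧ [x, y, x, y, x].Sublist v := by
  constructor
  · rintro ⟨w, hw, hi⟩
    obtain ⟨f, hf, rfl⟩ := hi.symm.exists_map (by simp [ababa])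
    refine ⟨f 0, f 1, fun h => ?_, by simpa [ababa] using hw⟩
    exact absurd (hf 0 (by simp [ababa]) 1 (by simp [ababa]) h) (by decide)
  · rintro ⟨x, y, hxy, h⟩
    refine ⟨_, h, SeqIso.symm ?_⟩
    have := SeqIso.of_map (u := ababa) (f := ![x, y]) (by
      intro i _ j _ h
      fin_cases i <;> fin_cases j <;> simp_all)
    simpa [ababa] using this

theorem numLetters_ababa : numLetters ababa = 2 := by decide

/-! ### Superlinearity of `Ex ababa` -/

/-- A sequence cut into *fans*, each followed by a gap: a list of pairs (fan, gap). -/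
abbrev FanSeq (α : Type*) := List (List α × List α)

namespace FanSeq

variable {α β : Type*}

/-- The sequence underlying a list of fans and gaps. -/
def word (S : FanSeq α) : List α := S.flatMap fun p => p.1 ++ p.2

/-- The letters of the fans. -/
def fans (S : FanSeq α) : List α := S.flatMap Prod.fst

@[simp] theorem word_nil : word ([] : FanSeq α) = [] := rfl

@[simp] theorem word_cons (p : List α × List α) (S : FanSeq α) :
    word (p :: S) = p.1 ++ p.2 ++ word S := by simp [word]

@[simp] theorem word_append (S T : FanSeq α) : word (S ++ T) = word S ++ word T := by simp [word]

@[simp] theorem fans_nil : fans ([] : FanSeq α) = [] := rfl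

@[simp] theorem fans_cons (p : List α × List α) (S : FanSeq α) :
    fans (p :: S) = p.1 ++ fans S := by simp [fans]

/-- A sequence without repetitions `aa` and without alternations `ababa`, cut into fans of size `m`
and gaps in such a way that every letter lies in a fan, and fans consist of first occurrences. -/
structure IsProper (m : ℕ) (S : FanSeq α) : Prop where
  ne_nil : S ≠ []
  length_fan : ∀ p ∈ S, p.1.length = m
  nodup : ∀ p ∈ S, p.1.Nodup
  first : S.Pairwise fun p q => ∀ x ∈ q.1, x ∉ p.1 ++ p.2
  gap : ∀ p ∈ S, ∀ x ∈ p.2, x ∈ fans S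
  chain : (word S).IsChain (· ≠ ·)
  avoids : ∀ x y, x ≠ y → ¬ [x, y, x, y, x].Sublist (word S)

theorem IsProper.mem_fans {m : ℕ} {S : FanSeq α} (h : IsProper m S) {x : α} (hx : x ∈ word S) :
    x ∈ fans S := by
  obtain ⟨p, hp, hx⟩ := List.mem_flatMap.1 hx
  rcases List.mem_append.1 hx with hx | hx
  · exact List.mem_flatMap.2 ⟨p, hp, hx⟩
  · exact h.gap p hp x hx

theorem length_fans {m : ℕ} {S : FanSeq α} (h : ∀ p ∈ S, p.1.length = m) :
    (fans S).length = m * S.length := by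
  induction S with
  | nil => simp
  | cons p S ih =>
    simp only [List.mem_cons, forall_eq_or_imp] at h
    simp [ih h.2, h.1]
    ring

/-- Append a sequence to the last gap. -/
def glue : FanSeq α → List α → FanSeq α
  | [], _ => []
  | [p], g => [(p.1, p.2 ++ g)]
  | p :: q :: t, g => p :: glue (q :: t) g

theorem word_glue {S : FanSeq α} (h : S ≠ []) (g : List α) : word (glue S g) = word S ++ g := by
  fun_induction glue S g <;> simp_all

theorem map_fst_glue (S : FanSeq α) (g : List α) :
    (glue S g).map Prod.fst = S.map Prod.fst := by
  fun_induction glue S g <;> simp_all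

theorem fans_glue (S : FanSeq α) (g : List α) : fans (glue S g) = fans S := by
  simp only [fans, List.flatMap_def, map_fst_glue]

theorem length_glue (S : FanSeq α) (g : List α) : (glue S g).length = S.length := by
  fun_induction glue S g <;> simp_all

theorem exists_of_mem_glue {S : FanSeq α} {g : List α} {p : List α × List α}
    (h : p ∈ glue S g) : ∃ q ∈ S, p.1 = q.1 ∧ ∀ x ∈ p.2, x ∈ q.2 ∨ x ∈ g := by
  fun_induction glue S g with
  | case1 => simp at h
  | case2 q g =>
    rw [List.mem_singleton] at h
    subst h
    exact ⟨q, by simp, rfl, fun x hx => List.mem_append.1 hx⟩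
  | case3 q r t g ih =>
    rcases List.mem_cons.1 h with rfl | h
    · exact ⟨p, by simp, rfl, fun x hx => Or.inl hx⟩
    · obtain ⟨q', hq', h'⟩ := ih h
      exact ⟨q', List.mem_cons_of_mem _ hq', h'⟩

theorem first_glue {S : FanSeq α} (g : List α)
    (h : S.Pairwise fun p q => ∀ x ∈ q.1, x ∉ p.1 ++ p.2) :
    (glue S g).Pairwise fun p q => ∀ x ∈ q.1, x ∉ p.1 ++ p.2 := by
  fun_induction glue S g with
  | case1 => simp
  | case2 => simp
  | case3 g p q t ih =>
    rw [List.pairwise_cons] at h ⊢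
    refine ⟨fun r hr => ?_, ih h.2⟩
    obtain ⟨r', hr', h1, -⟩ := exists_of_mem_glue hr
    rw [h1]
    exact h.1 r' hr'

/-- A copy of `T` on letters indexed by `i`, with the letters of a list inserted, one at the end of
each fan, and the previous last element of the fan repeated. -/
def fill (i : List α) : FanSeq β → List α → FanSeq (α ⊕ List α × β)
  | p :: T, a :: l =>
    (p.1.map (fun b => Sum.inr (i, b)) ++ [Sum.inl a],
      (p.1.getLast?.toList ++ p.2).map (fun b => Sum.inr (i, b))) :: fill i T l
  | _, _ => []

theorem length_fill (i : List α) (T : FanSeq β) (l : List α) (h : l.length = T.length) :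
    (fill i T l).length = T.length := by
  fun_induction fill i T l with
  | case1 p T a l ih => simpa using ih (by simpa using h)
  | case2 l T hx =>
    cases l <;> cases T <;> first | exact (hx _ _ _ _ rfl rfl).elim | simp_all

theorem exists_of_mem_fill {i : List α} {T : FanSeq β} {l : List α}
    {r : List (α ⊕ List α × β) × List (α ⊕ List α × β)} (h : r ∈ fill i T l) :
    ∃ p ∈ T, ∃ a ∈ l, r = (p.1.map (fun b => Sum.inr (i, b)) ++ [Sum.inl a],
      (p.1.getLast?.toList ++ p.2).map (fun b => Sum.inr (i, b))) := by
  fun_induction fill i T l with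
  | case1 p T a l ih =>
    rcases List.mem_cons.1 h with rfl | h
    · exact ⟨p, by simp, a, by simp, rfl⟩
    · obtain ⟨p', hp', a', ha', h⟩ := ih h
      exact ⟨p', by simp [hp'], a', by simp [ha'], h⟩
  | case2 => simp at h

theorem mem_getLast?_toList {l : List α} {x : α} (h : x ∈ l.getLast?.toList) : x ∈ l := by
  rw [Option.mem_toList] at h
  exact List.mem_of_getLast? h

theorem mem_word_fill {i : List α} {T : FanSeq β} {l : List α} {z : α ⊕ List α × β}
    (h : z ∈ word (fill i T l)) :
    (∃ a ∈ l, z = Sum.inl a) ∨ ∃ b ∈ word T, z = Sum.inr (i, b) := by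
  obtain ⟨r, hr, hz⟩ := List.mem_flatMap.1 h
  obtain ⟨p, hp, a, ha, rfl⟩ := exists_of_mem_fill hr
  have hw : ∀ b, b ∈ p.1 ∨ b ∈ p.2 → b ∈ word T := fun b hb =>
    List.mem_flatMap.2 ⟨p, hp, List.mem_append.2 hb⟩
  simp only [List.mem_append, List.mem_map, List.mem_singleton] at hz
  rcases hz with (⟨b, hb, rfl⟩ | rfl) | ⟨b, hb | hb, rfl⟩
  · exact Or.inr ⟨b, hw b (Or.inl hb), rfl⟩
  · exact Or.inl ⟨a, ha, rfl⟩
  · exact Or.inr ⟨b, hw b (Or.inl (mem_getLast?_toList hb)), rfl⟩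
  · exact Or.inr ⟨b, hw b (Or.inr hb), rfl⟩

theorem inl_mem_fans_fill {i : List α} {T : FanSeq β} {l : List α} (h : l.length = T.length)
    {a : α} (ha : a ∈ l) : Sum.inl a ∈ fans (fill i T l) := by
  fun_induction fill i T l with
  | case1 p T c l ih =>
    rcases List.mem_cons.1 ha with rfl | ha
    · simp
    · simp [ih (by simpa using h) ha]
  | case2 l T hx =>
    cases l <;> cases T <;> first | exact (hx _ _ _ _ rfl rfl).elim | simp_all

theorem inr_mem_fans_fill {i : List α} {T : FanSeq β} {l : List α} (h : l.length = T.length)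
    {b : β} (hb : b ∈ fans T) : Sum.inr (i, b) ∈ fans (fill i T l) := by
  fun_induction fill i T l with
  | case1 p T c l ih =>
    rw [fans_cons, List.mem_append] at hb
    rcases hb with hb | hb
    · simp [hb]
    · simp [ih (by simpa using h) hb]
  | case2 l T hx =>
    cases l <;> cases T <;> first | exact (hx _ _ _ _ rfl rfl).elim | simp_all

theorem first_fill (i : List α) {T : FanSeq β} {l : List α} (hl : l.Nodup)
    (h : T.Pairwise fun p q => ∀ x ∈ q.1, x ∉ p.1 ++ p.2) :
    (fill i T l).Pairwise fun p q => ∀ x ∈ q.1, x ∉ p.1 ++ p.2 := by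
  fun_induction fill i T l with
  | case1 p T c l ih =>
    rw [List.pairwise_cons] at h ⊢
    rw [List.nodup_cons] at hl
    refine ⟨fun r hr => ?_, ih hl.2 h.2⟩
    obtain ⟨q, hq, a, ha, rfl⟩ := exists_of_mem_fill hr
    have h1 := h.1 q hq
    have hca : a ≠ c := fun h => hl.1 (h ▸ ha)
    intro x hx
    simp only [List.mem_append, List.mem_map, List.mem_singleton] at hx h1 ⊢
    rcases hx with ⟨b, hb, rfl⟩ | rfl
    · have := h1 b hb
      have h3 : b ∉ p.1.getLast?.toList := fun h => this (Or.inl (mem_getLast?_toList h))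
      simp_all
    · simp [hca]
  | case2 => simp

/-- This projection serves twice: it shows that no inserted letter occurs twice in a copy when `l`
has no repetitions, and that the old letters of a composition spell out `word S`. -/
theorem filterMap_getLeft?_word_fill (i : List α) (T : FanSeq β) (l : List α)
    (h : l.length = T.length) : (word (fill i T l)).filterMap Sum.getLeft? = l := by
  fun_induction fill i T l with
  | case1 p T c l ih =>
    simp [List.filterMap_map, Function.comp_def, ih (by simpa using h)]
  | case2 l T hx =>
    cases l <;> cases T <;> first | exact (hx _ _ _ _ rfl rfl).elim | simp_all

theorem length_word_fill (i : List α) {T : FanSeq β} {l : List α}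
    (h : l.length = T.length) (hT : ∀ p ∈ T, p.1 ≠ []) :
    (word (fill i T l)).length = (word T).length + 2 * T.length := by
  fun_induction fill i T l with
  | case1 p T c l ih =>
    simp only [List.mem_cons, forall_eq_or_imp] at hT
    have := ih (by simpa using h) hT.2
    simp [this, List.getLast?_eq_getLast_of_ne_nil hT.1]
    ring
  | case2 l T hx =>
    cases l <;> cases T <;> first | exact (hx _ _ _ _ rfl rfl).elim | simp_all

/-- Every subsequence of `l` without immediate repetitions is a subsequence of `l'`. -/
def AltLe (l l' : List α) : Prop := ∀ p : List α, p.IsChain (· ≠ ·) → p.Sublist l → p.Sublist l'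

theorem AltLe.append {l₁ l₁' l₂ l₂' : List α} (h₁ : AltLe l₁ l₁') (h₂ : AltLe l₂ l₂') :
    AltLe (l₁ ++ l₂) (l₁' ++ l₂') := by
  intro p hp h
  obtain ⟨p₁, p₂, rfl, h1, h2⟩ := List.sublist_append_iff.1 h
  have := List.isChain_append.1 hp
  exact (h₁ _ this.1 h1).append (h₂ _ this.2.1 h2)

theorem AltLe.refl (l : List α) : AltLe l l := fun _ _ h => h

theorem altLe_cons_cons (c : α) : AltLe [c, c] [c] := by
  intro p hp h
  rcases p with _ | ⟨a, _ | ⟨b, p⟩⟩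
  · simp
  · have := h.subset (List.mem_singleton_self a)
    simp_all
  · have h1 := h.subset (show a ∈ a :: b :: p by simp)
    have h2 := h.subset (show b ∈ a :: b :: p by simp)
    simp_all

theorem altLe_append_getLast? (f : List α) : AltLe (f ++ f.getLast?.toList) f := by
  rcases List.eq_nil_or_concat f with rfl | ⟨f, c, rfl⟩
  · exact AltLe.refl _
  · simpa using (AltLe.refl f).append (altLe_cons_cons c)

/-- Removing the inserted letters leaves the copy of `T` with the last letter of each fan doubled,
and a doubled letter supports no new alternation. -/
theorem altLe_word_fill (i : List α) (T : FanSeq β) (l : List α) (h : l.length = T.length) :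
    AltLe ((word (fill i T l)).filterMap (fun z => z.getRight?.map Prod.snd)) (word T) := by
  fun_induction fill i T l with
  | case1 p T c l ih =>
    have h1 := ((altLe_append_getLast? p.1).append (AltLe.refl p.2)).append
      (ih (by simpa using h))
    simpa [List.filterMap_map, Function.comp_def, List.filterMap_cons] using h1
  | case2 l T hx =>
    cases l <;> cases T <;> first | exact (hx _ _ _ _ rfl rfl).elim | simp_all [AltLe]

/-- The inserted letter separates the two equal copies of the last letter of the fan. The end
letters are carried along because the induction and the composition both need them where blocks
meet. -/
theorem isChain_word_fill (i : List α) {T : FanSeq β} {l : List α} (h : l.length = T.length)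
    (hT : ∀ p ∈ T, p.1 ≠ []) (hc : (word T).IsChain (· ≠ ·)) :
    (word (fill i T l)).IsChain (· ≠ ·) ∧
      (word (fill i T l)).head? = (word T).head?.map (fun b => Sum.inr (i, b)) ∧
      (word (fill i T l)).getLast? = (word T).getLast?.map (fun b => Sum.inr (i, b)) := by
  fun_induction fill i T l with
  | case1 p T c l ih =>
    obtain ⟨f, g⟩ := p
    simp only [List.mem_cons, forall_eq_or_imp] at hT
    rw [word_cons, List.append_assoc, List.isChain_append, List.isChain_append] at hc
    obtain ⟨ih1, ih2, ih3⟩ := ih (by simpa using h) hT.2 hc.2.1.2.1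
    obtain ⟨b, hb⟩ : ∃ b, f.getLast? = some b := ⟨_, List.getLast?_eq_getLast_of_ne_nil hT.1⟩
    obtain ⟨d, hd⟩ : ∃ d, f.head? = some d := ⟨_, List.head?_eq_some_head hT.1⟩
    have inj : Function.Injective (fun b : β => (Sum.inr (i, b) : α ⊕ List α × β)) :=
      fun x y h => by simpa using h
    have cm : ∀ l : List β, l.IsChain (· ≠ ·) →
        (l.map (fun b : β => (Sum.inr (i, b) : α ⊕ List α × β))).IsChain (· ≠ ·) := fun l hl => by
      rw [List.isChain_map]
      exact hl.imp fun x y h h' => h (inj h')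
    have hg : ((b :: g) ++ word T).IsChain (· ≠ ·) := by
      have := hc.2.2
      rw [hb] at this
      rw [List.cons_append, List.isChain_cons, List.isChain_append]
      exact ⟨fun y hy => this b rfl y hy, hc.2.1⟩
    have hg' := List.isChain_append.1 hg
    refine ⟨?_, ?_, ?_⟩
    · rw [word_cons, List.append_assoc, List.append_assoc, List.isChain_append]
      refine ⟨cm _ hc.1, ?_, by simp⟩
      simp only [hb, Option.toList_some, List.singleton_append]
      rw [List.isChain_cons, List.isChain_append]
      refine ⟨by simp, cm _ hg'.1, ih1, ?_⟩
      rw [ih2, List.getLast?_map]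
      intro x hx y hy
      simp only [Option.mem_def, Option.map_eq_some_iff] at hx hy
      obtain ⟨x', hx', rfl⟩ := hx
      obtain ⟨y', hy', rfl⟩ := hy
      exact fun h => hg'.2.2 x' hx' y' hy' (inj h)
    · simp [hd]
    · rw [word_cons, word_cons, List.getLast?_append, List.getLast?_append, ih3]
      simp only [List.getLast?_append, List.getLast?_map, hb, Option.toList_some]
      cases (word T).getLast? <;> cases g.getLast? <;> simp
  | case2 l T hx =>
    cases l <;> cases T <;> first | exact (hx _ _ _ _ rfl rfl).elim | simp_all

end FanSeq

/-! ### Composition of fan sequences. -/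

namespace FanSeq

variable {α β : Type*}

theorem sublist_of_append_left {x : α} {p l l' : List α} (hx : x ∉ l)
    (h : (x :: p).Sublist (l ++ l')) : (x :: p).Sublist l' := by
  induction l with
  | nil => simpa using h
  | cons c l ih =>
    rw [List.mem_cons, not_or] at hx
    rw [List.cons_append] at h
    cases h with
    | cons _ h => exact ih hx.2 h
    | cons_cons _ h => exact (hx.1 rfl).elim

theorem sublist_of_append_right {x : α} {p l l' : List α} (hx : x ∉ l')
    (h : (p ++ [x]).Sublist (l ++ l')) : (p ++ [x]).Sublist l := by
  rw [← List.reverse_sublist] at h ⊢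
  simp only [List.reverse_append, List.reverse_singleton, List.singleton_append] at h ⊢
  exact sublist_of_append_left (by simpa using hx) h

theorem sublist_middle {x : α} {p l₁ l l₂ : List α} (h₁ : x ∉ l₁) (h₂ : x ∉ l₂)
    (h : (x :: p ++ [x]).Sublist (l₁ ++ l ++ l₂)) : (x :: p ++ [x]).Sublist l := by
  rw [List.append_assoc] at h
  exact sublist_of_append_right h₂ (sublist_of_append_left h₁ h)

/-- Replace every fan of `S` by a copy of `T`, spreading the letters of the fan over the ends of
the fans of `T`. -/
def compose (T : FanSeq β) (S : FanSeq α) : FanSeq (α ⊕ List α × β) :=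
  S.flatMap fun p => glue (fill p.1 T p.1) (p.2.map Sum.inl)

theorem compose_cons (T : FanSeq β) (p : List α × List α) (S : FanSeq α) :
    compose T (p :: S) = glue (fill p.1 T p.1) (p.2.map Sum.inl) ++ compose T S := by
  simp [compose]

theorem fill_ne_nil {i l : List α} {T : FanSeq β} (hT : T ≠ []) (h : l.length = T.length) :
    fill i T l ≠ [] := by
  rw [← List.length_pos_iff, length_fill i T l h]
  exact List.length_pos_iff.2 hT

theorem word_compose {T : FanSeq β} {S : FanSeq α} (hT : T ≠ [])
    (hS : ∀ p ∈ S, p.1.length = T.length) :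
    word (compose T S) = S.flatMap fun p => word (fill p.1 T p.1) ++ p.2.map Sum.inl := by
  induction S with
  | nil => rfl
  | cons p S ih =>
    simp only [List.mem_cons, forall_eq_or_imp] at hS
    rw [compose_cons, word_append, word_glue (fill_ne_nil hT hS.1), ih hS.2, List.flatMap_cons]

theorem length_compose {T : FanSeq β} {S : FanSeq α}
    (hS : ∀ p ∈ S, p.1.length = T.length) : (compose T S).length = T.length * S.length := by
  induction S with
  | nil => simp [compose]
  | cons p S ih =>
    simp only [List.mem_cons, forall_eq_or_imp] at hS
    rw [compose_cons, List.length_append, length_glue, length_fill _ _ _ hS.1, ih hS.2,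
      List.length_cons]
    ring

/-- Each copy of `T` gains an inserted letter and a repeated letter per fan. The inserted ones are
counted in `word S`, which leaves one extra letter per fan of the copy. -/
theorem length_word_compose {T : FanSeq β} {S : FanSeq α} (hT : T ≠ [])
    (hT' : ∀ p ∈ T, p.1 ≠ []) (hS : ∀ p ∈ S, p.1.length = T.length) :
    (word (compose T S)).length =
      S.length * ((word T).length + T.length) + (word S).length := by
  rw [word_compose hT hS]
  induction S with
  | nil => simp
  | cons p S ih =>
    simp only [List.mem_cons, forall_eq_or_imp] at hS
    rw [List.flatMap_cons, List.length_append, ih hS.2, List.length_append,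
      length_word_fill _ hS.1 hT', word_cons]
    simp only [List.length_append, List.length_map, List.length_cons, hS.1]
    ring

theorem filterMap_getLeft?_word_compose {T : FanSeq β} {S : FanSeq α} (hT : T ≠ [])
    (hS : ∀ p ∈ S, p.1.length = T.length) :
    (word (compose T S)).filterMap Sum.getLeft? = word S := by
  rw [word_compose hT hS]
  induction S with
  | nil => simp
  | cons p S ih =>
    simp only [List.mem_cons, forall_eq_or_imp] at hS
    rw [List.flatMap_cons, List.filterMap_append, ih hS.2, List.filterMap_append,
      filterMap_getLeft?_word_fill _ _ _ hS.1, word_cons]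
    simp [List.filterMap_map, Function.comp_def]

theorem fans_compose (T : FanSeq β) (S : FanSeq α) :
    fans (compose T S) = S.flatMap fun p => fans (fill p.1 T p.1) := by
  induction S with
  | nil => rfl
  | cons p S ih =>
    rw [List.flatMap_cons, ← ih, compose_cons, ← fans_glue (fill p.1 T p.1) (p.2.map Sum.inl)]
    simp [fans]

variable {m : ℕ} {T : FanSeq β} {S : FanSeq α}

theorem IsProper.fan_ne_nil (hm : 0 < m) (hT : IsProper m T) : ∀ p ∈ T, p.1 ≠ [] := by
  intro p hp h
  have := hT.length_fan p hp
  simp_all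

/-- Distinct fans have no common letters. -/
theorem IsProper.pairwise_disjoint (hS : IsProper m S) :
    S.Pairwise fun p q => ∀ x ∈ q.1, x ∉ p.1 :=
  hS.first.imp fun h x hx hx' => h x hx (List.mem_append_left _ hx')

/-- This makes the fan itself a valid label for its copy of `T`: letters `Sum.inr (i, b)` from
different copies never coincide. -/
theorem IsProper.pairwise_ne (hm : 0 < m) (hS : IsProper m S) :
    S.Pairwise fun p q => p.1 ≠ q.1 := by
  refine hS.pairwise_disjoint.imp_of_mem fun {p q} hp hq h heq => ?_
  obtain ⟨x, hx⟩ := List.exists_mem_of_ne_nil _ (hS.fan_ne_nil hm q hq)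
  exact h x hx (heq ▸ hx)

theorem IsProper.first_compose (hT : IsProper m T) (hS : IsProper T.length S) :
    (compose T S).Pairwise fun p q => ∀ x ∈ q.1, x ∉ p.1 ++ p.2 := by
  have hpos : 0 < T.length := List.length_pos_iff.2 hT.ne_nil
  rw [compose, List.pairwise_flatMap]
  refine ⟨fun p hp => first_glue _ (first_fill _ (hS.nodup p hp) hT.first), ?_⟩
  refine (hS.first.and (hS.pairwise_ne hpos)).imp ?_
  rintro p q ⟨h, hne⟩ r hr s hs x hx hx'
  obtain ⟨r', hr', hr1, hr2⟩ := exists_of_mem_glue hr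
  obtain ⟨s', hs', hs1, -⟩ := exists_of_mem_glue hs
  rw [hs1] at hx
  obtain ⟨-, -, a, ha, -⟩ := exists_of_mem_fill hs'
  have hx1 := mem_word_fill (List.mem_flatMap.2 ⟨s', hs', List.mem_append_left _ hx⟩)
  have hx2 : x ∈ word (fill p.1 T p.1) ∨ x ∈ p.2.map Sum.inl := by
    rcases List.mem_append.1 hx' with hx' | hx'
    · exact Or.inl (List.mem_flatMap.2 ⟨r', hr', List.mem_append_left _ (hr1 ▸ hx')⟩)
    · exact (hr2 x hx').imp_left fun hx' =>
        List.mem_flatMap.2 ⟨r', hr', List.mem_append_right _ hx'⟩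
  rw [List.mem_map] at hx2
  rcases hx1 with ⟨a, ha, rfl⟩ | ⟨b, -, rfl⟩
  · refine h a ha (List.mem_append.2 ?_)
    refine hx2.imp (fun h2 => ?_) (fun h2 => ?_)
    · rcases mem_word_fill h2 with ⟨a', ha', h3⟩ | ⟨b', -, h3⟩
      · simpa [Sum.inl.inj h3] using ha'
      · simp at h3
    · obtain ⟨a', ha', h3⟩ := h2
      simpa [Sum.inl.inj h3] using ha'
  · rcases hx2 with h2 | ⟨a', -, h3⟩
    · rcases mem_word_fill h2 with ⟨a', -, h3⟩ | ⟨b', -, h3⟩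
      · simp at h3
      · simp only [Sum.inr.injEq, Prod.mk.injEq] at h3
        exact hne h3.1.symm
    · simp at h3

theorem IsProper.gap_compose (hT : IsProper m T) (hS : IsProper T.length S) :
    ∀ p ∈ compose T S, ∀ x ∈ p.2, x ∈ fans (compose T S) := by
  intro r hr x hx
  obtain ⟨p, hp, hr⟩ := List.mem_flatMap.1 hr
  obtain ⟨r', hr', -, h⟩ := exists_of_mem_glue hr
  rw [fans_compose]
  rcases h x hx with hx | hx
  · refine List.mem_flatMap.2 ⟨p, hp, ?_⟩
    rcases mem_word_fill (List.mem_flatMap.2 ⟨r', hr', List.mem_append_right _ hx⟩) with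
      ⟨a, ha, rfl⟩ | ⟨b, hb, rfl⟩
    · exact inl_mem_fans_fill (hS.length_fan p hp) ha
    · exact inr_mem_fans_fill (hS.length_fan p hp) (hT.mem_fans hb)
  · obtain ⟨a, ha, rfl⟩ := List.mem_map.1 hx
    obtain ⟨q, hq, haq⟩ := List.mem_flatMap.1 (hS.gap p hp a ha)
    exact List.mem_flatMap.2 ⟨q, hq, inl_mem_fans_fill (hS.length_fan q hq) haq⟩

theorem IsProper.chain_compose (hm : 0 < m) (hT : IsProper m T) (hS : IsProper T.length S) :
    (word (compose T S)).IsChain (· ≠ ·) := by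
  have hpos : 0 < T.length := List.length_pos_iff.2 hT.ne_nil
  have hne := hS.pairwise_ne hpos
  have hlen := hS.length_fan
  have hch := hS.chain
  rw [word_compose hT.ne_nil hlen]
  clear hS
  obtain ⟨b, hb⟩ : ∃ b, (word T).head? = some b := by
    obtain ⟨p, T, rfl⟩ := List.exists_cons_of_ne_nil hT.ne_nil
    have := hT.fan_ne_nil hm p (by simp)
    exact ⟨p.1.head this, by simp [List.head?_eq_some_head this]⟩
  obtain ⟨d, hd⟩ : ∃ d, (word T).getLast? = some d :=
    ⟨_, List.getLast?_eq_getLast_of_ne_nil (by rintro h; simp [h] at hb)⟩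
  induction S with
  | nil => simp
  | cons p S ih =>
    simp only [List.mem_cons, forall_eq_or_imp] at hlen
    rw [List.pairwise_cons] at hne
    rw [word_cons, List.append_assoc, List.isChain_append, List.isChain_append] at hch
    obtain ⟨h1, h2, h3⟩ :=
      isChain_word_fill p.1 hlen.1 (hT.fan_ne_nil hm) hT.chain
    rw [hb] at h2
    rw [hd] at h3
    rw [List.flatMap_cons, List.isChain_append, List.isChain_append]
    refine ⟨⟨h1, ?_, ?_⟩, ih hne.2 hlen.2 hch.2.1.2.1, ?_⟩
    · rw [List.isChain_map]
      exact hch.2.1.1.imp fun x y h h' => h (Sum.inl.inj h')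
    · rw [h3]
      intro x hx y hy
      simp at hx hy
      obtain ⟨y', -, rfl⟩ := hy
      simp [← hx]
    · intro x hx y hy
      rcases S with _ | ⟨q, S⟩
      · simp at hy
      · have h4 := (isChain_word_fill q.1 (hlen.2 q (by simp)) (hT.fan_ne_nil hm) hT.chain).2.1
        have h5 := hne.1 q (by simp)
        rw [List.flatMap_cons, List.head?_append, List.head?_append, h4, hb] at hy
        rw [List.getLast?_append, h3] at hx
        simp only [Option.map_some, Option.some_or, Option.mem_def, Option.some.injEq] at hy
        subst hy
        cases hg : p.2.getLast? with
        | none =>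
          simp [hg] at hx
          subst hx
          simp [h5]
        | some c =>
          simp [hg] at hx
          simp [← hx]

/-- Two old letters project to `S`. Two new letters lie in one copy, where `T` forbids the
alternation. If `x` is new and `y` old, the whole pattern lies in the copy of `x`, which holds each
old letter at most once. If `x` is old and `y` new, the middle `x` lies in the copy of `y`; an old
letter there has no earlier occurrence outside the copy, so the first `x` lies there too, again
giving two. -/
theorem IsProper.avoids_compose (hT : IsProper m T) (hS : IsProper T.length S)
    (x y : α ⊕ List α × β) (hxy : x ≠ y) : ¬ [x, y, x, y, x].Sublist (word (compose T S)) := by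
  intro h
  have hpos : 0 < T.length := List.length_pos_iff.2 hT.ne_nil
  have hsplit : ∀ i b, Sum.inr (i, b) ∈ word (compose T S) → ∃ P Q,
      word (compose T S) = P ++ word (fill i T i) ++ Q ∧ i.length = T.length ∧ i.Nodup ∧
      (∀ c, Sum.inr (i, c) ∉ P) ∧ (∀ c, Sum.inr (i, c) ∉ Q) ∧ ∀ a ∈ i, Sum.inl a ∉ P := by
    intro i b hib
    rw [word_compose hT.ne_nil hS.length_fan] at hib ⊢
    obtain ⟨p, hp, hib⟩ := List.mem_flatMap.1 hib
    rcases List.mem_append.1 hib with hib | hib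
    · rcases mem_word_fill hib with ⟨a, -, h3⟩ | ⟨b', -, h3⟩
      · simp at h3
      simp only [Sum.inr.injEq, Prod.mk.injEq] at h3
      obtain ⟨rfl, -⟩ := h3
      obtain ⟨S₁, S₂, rfl⟩ := List.append_of_mem hp
      have hne := hS.pairwise_ne hpos
      have hfirst := hS.first
      rw [List.pairwise_append] at hne hfirst
      have hno : ∀ q : List α × List α, q.1 ≠ p.1 → ∀ c : β,
          Sum.inr (p.1, c) ∉ word (fill q.1 T q.1) ++ q.2.map Sum.inl := by
        intro q hq c hc
        rcases List.mem_append.1 hc with hc | hc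
        · rcases mem_word_fill hc with ⟨a, -, h3⟩ | ⟨b', -, h3⟩
          · simp at h3
          · simp only [Sum.inr.injEq, Prod.mk.injEq] at h3
            exact hq h3.1.symm
        · simp at hc
      refine ⟨S₁.flatMap (fun p => word (fill p.1 T p.1) ++ p.2.map Sum.inl), p.2.map Sum.inl ++
        S₂.flatMap (fun p => word (fill p.1 T p.1) ++ p.2.map Sum.inl),
        by simp only [List.flatMap_append, List.flatMap_cons, List.append_assoc],
        hS.length_fan p hp, hS.nodup p hp, ?_, ?_, ?_⟩
      · intro c hc
        obtain ⟨q, hq, hc⟩ := List.mem_flatMap.1 hc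
        exact hno q (hne.2.2 q hq p (by simp)) c hc
      · intro c hc
        rcases List.mem_append.1 hc with hc | hc
        · simp at hc
        · obtain ⟨q, hq, hc⟩ := List.mem_flatMap.1 hc
          exact hno q ((List.pairwise_cons.1 hne.2.1).1 q hq).symm c hc
      · intro a ha hc
        obtain ⟨q, hq, hc⟩ := List.mem_flatMap.1 hc
        refine hfirst.2.2 q hq p (by simp) a ha (List.mem_append.2 ?_)
        refine (List.mem_append.1 hc).imp (fun hc => ?_) (fun hc => ?_)
        · rcases mem_word_fill hc with ⟨a', ha', h3⟩ | ⟨b', -, h3⟩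
          · rwa [Sum.inl.inj h3]
          · simp at h3
        · simpa using hc
    · simp at hib
  have once : ∀ i : List α, i.length = T.length → i.Nodup → ∀ a : α,
      ¬ [Sum.inl a, Sum.inl a].Sublist (word (fill i T i)) := by
    intro i hi hnd a h2
    have := h2.filterMap Sum.getLeft?
    rw [filterMap_getLeft?_word_fill _ _ _ hi] at this
    have := hnd.sublist this
    simp at this
  have other : ∀ (i j : List α) (b : β), i ≠ j → Sum.inr (j, b) ∉ word (fill i T i) := by
    intro i j b hij h2
    rcases mem_word_fill h2 with ⟨a, -, h3⟩ | ⟨b', -, h3⟩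
    · simp at h3
    · simp only [Sum.inr.injEq, Prod.mk.injEq] at h3
      exact hij h3.1.symm
  rcases x with a | ⟨i, b⟩
  · rcases y with a' | ⟨j, c⟩
    · refine hS.avoids a a' (fun h => hxy (h ▸ rfl)) ?_
      have := h.filterMap Sum.getLeft?
      rw [filterMap_getLeft?_word_compose hT.ne_nil hS.length_fan] at this
      simpa [List.filterMap_cons] using this
    · obtain ⟨P, Q, hw, hl, hnd, hP, hQ, hfst⟩ := hsplit j c (h.subset (by simp))
      rw [hw] at h
      have h1 : [Sum.inr (j, c), Sum.inl a, Sum.inr (j, c)].Sublist (word (fill j T j)) :=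
        sublist_middle (p := [Sum.inl a]) (hP c) (hQ c)
          (List.Sublist.trans (by
            exact (List.Sublist.cons _ (List.Sublist.cons_cons _
              (List.Sublist.cons_cons _ (List.Sublist.cons_cons _ (by simp)))))) h)
      have ha : a ∈ j := by
        rcases mem_word_fill (h1.subset (show Sum.inl a ∈ _ by simp)) with ⟨a', ha', h3⟩ | ⟨_, _, h3⟩
        · rwa [Sum.inl.inj h3]
        · simp at h3
      rw [List.append_assoc] at h
      have h2 := sublist_of_append_left (hfst a ha) h
      have h3 : [Sum.inl a, Sum.inr (j, c), Sum.inl a, Sum.inr (j, c)].Sublist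
          (word (fill j T j)) :=
        sublist_of_append_right (p := [Sum.inl a, Sum.inr (j, c), Sum.inl a]) (hQ c)
          (List.Sublist.trans (by simp) h2)
      exact once j hl hnd a (List.Sublist.trans (by simp) h3)
  · obtain ⟨P, Q, hw, hl, hnd, hP, hQ, hfst⟩ := hsplit i b (h.subset (by simp))
    rw [hw] at h
    have h1 : [Sum.inr (i, b), y, Sum.inr (i, b), y, Sum.inr (i, b)].Sublist (word (fill i T i)) :=
      sublist_middle (p := [y, Sum.inr (i, b), y]) (hP b) (hQ b) h
    rcases y with a | ⟨j, c⟩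
    · refine once i hl hnd a (List.Sublist.trans ?_ h1)
      exact List.Sublist.cons _ (List.Sublist.cons_cons _ (List.Sublist.cons _ (by simp)))
    · by_cases hij : i = j
      · subst hij
        have h2 := h1.filterMap (fun z => z.getRight?.map Prod.snd)
        have hbc : b ≠ c := fun h => hxy (h ▸ rfl)
        exact hT.avoids b c hbc (altLe_word_fill i T i hl _ (by simp [hbc, hbc.symm])
          (by simpa [List.filterMap_cons] using h2))
      · exact other i j c hij (h1.subset (by simp))

theorem IsProper.compose (hm : 0 < m) (hT : IsProper m T) (hS : IsProper T.length S) :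
    IsProper (m + 1) (compose T S) where
  ne_nil := by
    rw [← List.length_pos_iff, length_compose hS.length_fan]
    exact Nat.mul_pos (List.length_pos_iff.2 hT.ne_nil) (List.length_pos_iff.2 hS.ne_nil)
  length_fan := by
    intro r hr
    obtain ⟨p, hp, hr⟩ := List.mem_flatMap.1 hr
    obtain ⟨r', hr', h1, -⟩ := exists_of_mem_glue hr
    obtain ⟨q, hq, a, ha, rfl⟩ := exists_of_mem_fill hr'
    simp [h1, hT.length_fan q hq]
  nodup := by
    intro r hr
    obtain ⟨p, hp, hr⟩ := List.mem_flatMap.1 hr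
    obtain ⟨r', hr', h1, -⟩ := exists_of_mem_glue hr
    obtain ⟨q, hq, a, ha, rfl⟩ := exists_of_mem_fill hr'
    rw [h1]
    refine List.nodup_append.2 ⟨(hT.nodup q hq).map fun x y h => by simpa using h, by simp, ?_⟩
    simp
  first := hT.first_compose hS
  gap := hT.gap_compose hS
  chain := hT.chain_compose hm hS
  avoids := hT.avoids_compose hS

/-! ### Unbounded density. -/

theorem isProper_of_nodup {M : ℕ} {S : FanSeq α} (hne : S ≠ [])
    (hlen : ∀ p ∈ S, p.1.length = M) (hgap : ∀ p ∈ S, p.2 = []) (hnd : (word S).Nodup) :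
    IsProper M S where
  ne_nil := hne
  length_fan := hlen
  nodup p hp := hnd.sublist
    ((List.sublist_append_left _ _).trans (List.sublist_flatten_of_mem (List.mem_map.2 ⟨p, hp, rfl⟩)))
  first := by
    refine (List.nodup_flatMap.1 hnd).2.imp ?_
    intro p q h x hx hx'
    exact h hx' (List.mem_append_left _ hx)
  gap p hp x hx := by simp [hgap p hp] at hx
  chain := hnd.isChain
  avoids x y _ h := by
    have := hnd.sublist h
    simp at this

/-- Fan sequences of arbitrarily large density exist. -/
theorem exists_isProper (c : ℕ) : ∃ m₀ : ℕ, 0 < m₀ ∧ ∀ m, m₀ ≤ m →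
    ∃ (α : Type) (S : FanSeq α), IsProper m S ∧ c * (m * S.length) ≤ 2 * (word S).length := by
  induction c with
  | zero =>
    refine ⟨1, one_pos, fun m _ => ⟨ℕ, [(List.range m, [])], ?_, by simp⟩⟩
    exact isProper_of_nodup (by simp) (by simp) (by simp) (by simp [List.nodup_range])
  | succ c ih =>
    obtain ⟨M, hM, ih⟩ := ih
    -- Composition raises the fan size by one at a time. The bound `M ≤ S.length` keeps the number
    -- of fans admissible as a fan size in the outer hypothesis.
    have key : ∀ m : ℕ, ∃ (α : Type) (S : FanSeq α), IsProper (m + 1) S ∧ M ≤ S.length ∧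
        (2 + m * (2 + c)) * S.length ≤ 2 * (word S).length := by
      intro m
      induction m with
      | zero =>
        refine ⟨ℕ, (List.range M).map fun i => ([i], []), ?_, by simp, ?_⟩
        · refine isProper_of_nodup (by simpa using hM.ne') (by simp) (by simp) ?_
          simp [word, List.flatMap_map, List.nodup_range]
        · simp [word, List.flatMap_map]
      | succ m ihm =>
        obtain ⟨β, T, hT, hMT, hd⟩ := ihm
        obtain ⟨α, S, hS, hd'⟩ := ih T.length hMT
        refine ⟨_, FanSeq.compose T S, hT.compose m.succ_pos hS, ?_, ?_⟩
        · rw [length_compose hS.length_fan]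
          exact hMT.trans (Nat.le_mul_of_pos_right _ (List.length_pos_iff.2 hS.ne_nil))
        · rw [length_compose hS.length_fan,
            length_word_compose hT.ne_nil (hT.fan_ne_nil m.succ_pos) hS.length_fan]
          -- Per fan of the composition, twice the length grows by `2` from the repeated letters and
          -- by at least `c` from `word S`, which explains the slope `2 + c`.
          have := Nat.mul_le_mul_left S.length hd
          nlinarith
    -- With `m = n + 1`, the required `(c + 1) * (n + 1) ≤ 2 + n * (2 + c)` amounts to `c ≤ n + 1`.
    refine ⟨c + 1, c.succ_pos, fun m hm => ?_⟩
    obtain ⟨n, rfl⟩ : ∃ n, m = n + 1 := ⟨m - 1, by omega⟩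
    obtain ⟨α, S, hS, -, hd⟩ := key n
    refine ⟨α, S, hS, le_trans ?_ hd⟩
    rw [← mul_assoc]
    refine Nat.mul_le_mul_right _ ?_
    nlinarith

end FanSeq

theorem exists_mul_le_two_mul_Ex_ababa (c : ℕ) : ∃ n, 0 < n ∧ c * n ≤ 2 * Ex ababa n := by
  classical
  obtain ⟨m, hm, h⟩ := FanSeq.exists_isProper c
  obtain ⟨α, S, hS, hd⟩ := h m le_rfl
  set w := FanSeq.word S with hw
  have hle : w.toFinset.card ≤ m * S.length := by
    rw [← FanSeq.length_fans hS.length_fan]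
    refine le_trans (Finset.card_le_card ?_) (List.toFinset_card_le _)
    intro x hx
    simpa using hS.mem_fans (by simpa using hx)
  have hpos : 0 < w.toFinset.card := by
    obtain ⟨p, T, rfl⟩ := List.exists_cons_of_ne_nil hS.ne_nil
    obtain ⟨x, hx⟩ := List.exists_mem_of_ne_nil _ (hS.fan_ne_nil hm p (by simp))
    exact Finset.card_pos.2 ⟨x, by simp [hw, hx]⟩
  refine ⟨w.toFinset.card, hpos, (Nat.mul_le_mul_left c hle).trans (hd.trans ?_)⟩
  refine Nat.mul_le_mul_left 2 ?_
  let f : α → Fin w.toFinset.card := fun x =>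
    if hx : x ∈ w.toFinset then w.toFinset.equivFin ⟨x, hx⟩ else ⟨0, hpos⟩
  have hf : ∀ x ∈ w, ∀ y ∈ w, f x = f y → x = y := by
    intro x hx y hy hxy
    simpa [f, hx, hy] using hxy
  rw [← List.length_map (as := w) f]
  refine length_le_Ex (by simp [ababa]) ?_ ?_
  · rw [seqContains_ababa_iff]
    rintro ⟨x, y, hxy, hs⟩
    obtain ⟨l, hl, he⟩ := List.sublist_map_iff.1 hs
    obtain ⟨a, l, rfl, h1, he⟩ := List.map_eq_cons_iff.1 he.symm
    obtain ⟨b, l, rfl, h2, he⟩ := List.map_eq_cons_iff.1 he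
    obtain ⟨a', l, rfl, h3, he⟩ := List.map_eq_cons_iff.1 he
    obtain ⟨b', l, rfl, h4, he⟩ := List.map_eq_cons_iff.1 he
    obtain ⟨a'', l, rfl, h5, he⟩ := List.map_eq_cons_iff.1 he
    obtain rfl := List.map_eq_nil_iff.1 he
    have ma := hl.subset (show a ∈ _ by simp)
    have mb := hl.subset (show b ∈ _ by simp)
    have ma' := hl.subset (show a' ∈ _ by simp)
    have mb' := hl.subset (show b' ∈ _ by simp)
    have ma'' := hl.subset (show a'' ∈ _ by simp)
    obtain rfl := hf a ma a' ma' (by rw [h1, h3])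
    obtain rfl := hf a ma a'' ma'' (by rw [h1, h5])
    obtain rfl := hf b mb b' mb' (by rw [h2, h4])
    refine hS.avoids a b ?_ hl
    rintro rfl
    exact hxy (h1.symm.trans h2)
  · rw [numLetters_ababa]
    apply isSparse_two_of_isChain
    rw [List.isChain_map]
    have := hS.chain
    refine List.IsChain.imp_of_mem_imp ?_ this
    exact fun x y hx hy h h' => h (hf x hx y hy h')

theorem not_isBigO_Ex_ababa :
    ¬ (fun n : ℕ => (Ex ababa n : ℝ)) =O[Filter.atTop] (fun n : ℕ => (n : ℝ)) := by
  intro h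
  obtain ⟨C, hC⟩ := h.bound
  obtain ⟨N, hN⟩ := Filter.eventually_atTop.1 hC
  obtain ⟨K, hK⟩ := exists_nat_gt C
  -- The size of `n` is not controlled, so the sum of the values below `N` is built into the
  -- constant: it rules out `n < N`.
  obtain ⟨n, hn, hc⟩ := exists_mul_le_two_mul_Ex_ababa
    (2 * (K + ∑ i ∈ Finset.range N, Ex ababa i + 1))
  have h1 : (K + ∑ i ∈ Finset.range N, Ex ababa i + 1) * n ≤ Ex ababa n := by linarith
  by_cases hnN : n < N
  · have h2 := Finset.single_le_sum (f := fun i => Ex ababa i) (fun i _ => Nat.zero_le _)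
      (Finset.mem_range.2 hnN)
    have h3 := Nat.le_mul_of_pos_right (K + ∑ i ∈ Finset.range N, Ex ababa i + 1) hn
    have h2' : Ex ababa n ≤ ∑ i ∈ Finset.range N, Ex ababa i := h2
    omega
  · have h2 := hN n (not_lt.1 hnN)
    simp only [Real.norm_natCast] at h2
    have h3 : K * n < Ex ababa n :=
      lt_of_lt_of_le (Nat.mul_lt_mul_of_pos_right (by omega) hn) h1
    have h4 : ((K * n : ℕ) : ℝ) < Ex ababa n := by exact_mod_cast h3
    have h5 : (0 : ℝ) < n := by exact_mod_cast hn
    push_cast at h4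
    nlinarith

/-! ### Minimally non-linear sequences contain no three consecutive equal letters -/

theorem mem_rtake_of_suffix {α : Type*} {l s : List α} {n : ℕ} (h : s <:+ l)
    (hs : s.length ≤ n) {x : α} (hx : x ∈ s) : x ∈ l.rtake n := by
  obtain ⟨t, rfl⟩ := h
  rw [List.rtake_eq_reverse_take_reverse, List.mem_reverse, List.reverse_append,
    List.take_append, List.mem_append]
  refine Or.inl ?_
  rw [List.take_of_length_le (by simpa using hs)]
  simpa using hx

theorem length_rtake_le {α : Type*} (l : List α) (n : ℕ) : (l.rtake n).length ≤ n := by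
  rw [List.rtake_eq_reverse_take_reverse]
  simp

/-- A greedy choice: an `r`-sparse sequence `v` has an `r`-sparse subsequence `w` of length at
least proportional to that of `v`, such that two equal letters of `w` are always separated
by a further occurrence in `v`. -/
theorem exists_thinning {α : Type*} {r : ℕ} (hr : 0 < r) (v : List α) (hv : IsSparse r v) :
    ∃ w : List α, w.Sublist v ∧ IsSparse r w ∧ v.length ≤ (2 * w.length + 1) * r ∧
      ∀ p q x, (p ++ [x, x] ++ q).Sublist w → (p ++ [x, x, x] ++ q).Sublist v := by
  classical
  -- The sequence `v` is read from left to right. `w` is the choice so far, `s` the letters passed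
  -- over since the last choice or deliberate skip, `N` the letters whose next eligible occurrence
  -- is to be skipped, and `B` the number of deliberate skips. Each skip is charged to an earlier
  -- choice, so `B + N.card ≤ w.length`. Sparsity is stated for all lengths up to `r` so that it
  -- covers short suffixes.
  suffices h : ∃ (w s v₀ : List α) (N : Finset α) (B : ℕ), v = v₀ ++ s ∧ w.Sublist v ∧
      (∀ z, z <:+: w → z.length ≤ r → z.Nodup) ∧
      (∀ p q x, (p ++ [x, x] ++ q).Sublist w → (p ++ [x, x, x] ++ q).Sublist v) ∧
      (∀ x, x ∉ N → ∀ p, (p ++ [x]).Sublist w → (p ++ [x, x]).Sublist v) ∧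
      B + N.card ≤ w.length ∧ v.length ≤ (w.length + B) * r + s.length ∧
      s.length < r ∧ ∀ x ∈ s, x ∈ w.rtake (r - 1) by
    obtain ⟨w, s, v₀, N, B, -, hw, hsp, hd, -, hB, hl, hs, -⟩ := h
    refine ⟨w, hw, fun z hz hzr => hsp z hz hzr.le, hl.trans ?_, hd⟩
    have : (w.length + B) * r ≤ 2 * w.length * r := Nat.mul_le_mul_right _ (by omega)
    have : (2 * w.length + 1) * r = 2 * w.length * r + r := by ring
    omega
  induction v using List.reverseRecOn with
  | nil =>
    refine ⟨[], [], [], ∅, 0, rfl, by simp, by simp, by simp, by simp, by simp, by simp,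
      by simpa using hr, by simp⟩
  | append_singleton v x ih =>
    obtain ⟨w, s, v₀, N, B, rfl, hw, hsp, hd, hN, hB, hl, hs, hsw⟩ :=
      ih fun z hz => hv z (hz.trans (List.prefix_append _ _).isInfix)
    have hw' : w.Sublist (v₀ ++ s ++ [x]) := hw.trans (List.sublist_append_left _ _)
    have hd' : ∀ p q y, (p ++ [y, y] ++ q).Sublist w →
        (p ++ [y, y, y] ++ q).Sublist (v₀ ++ s ++ [x]) := fun p q y h =>
      (hd p q y h).trans (List.sublist_append_left _ _)
    have hN' : ∀ y, y ∉ N → ∀ p, (p ++ [y]).Sublist w →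
        (p ++ [y, y]).Sublist (v₀ ++ s ++ [x]) := fun y hy p h =>
      (hN y hy p h).trans (List.sublist_append_left _ _)
    by_cases hx : x ∈ w.rtake (r - 1)
    · refine ⟨w, s ++ [x], v₀, N, B, by simp, hw', hsp, hd', hN', hB,
        by simp only [List.length_append, List.length_singleton] at hl ⊢; omega, ?_, ?_⟩
      -- Otherwise `r` distinct consecutive letters of `v` would all lie among the last `r - 1`
      -- letters of `w`.
      · by_contra! hlen
        have hsw' : ∀ y ∈ s ++ [x], y ∈ w.rtake (r - 1) := by
          simpa [or_imp, forall_and] using ⟨hsw, hx⟩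
        have hnd := hv ((s ++ [x]).take r)
          ((List.take_prefix _ _).isInfix.trans ⟨v₀, [], by simp⟩)
          (by rw [List.length_take]; omega)
        have := (hnd.subperm (l₂ := w.rtake (r - 1))
          fun y hy => hsw' y (List.mem_of_mem_take hy)).length_le
        have := length_rtake_le w (r - 1)
        rw [List.length_take] at *
        omega
      · simpa [or_imp, forall_and] using ⟨hsw, hx⟩
    -- A letter in `N` is skipped, which supplies the separating occurrence; any other letter is
    -- chosen and enters `N`.
    · by_cases hxN : x ∈ N
      · refine ⟨w, [], v₀ ++ s ++ [x], N.erase x, B + 1, by simp, hw', hsp, hd', ?_, ?_, ?_,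
          by simpa using hr, by simp⟩
        · intro y hy p h
          by_cases hyx : y = x
          · subst hyx
            simpa using (h.trans hw).append (List.Sublist.refl [y])
          · exact hN' y (fun h => hy (Finset.mem_erase.2 ⟨hyx, h⟩)) p h
        · have := Finset.card_erase_add_one hxN
          omega
        · simp only [List.length_append, List.length_singleton, List.length_nil] at hl ⊢
          have : (w.length + (B + 1)) * r = (w.length + B) * r + r := by ring
          omega
      · refine ⟨w ++ [x], [], v₀ ++ s ++ [x], insert x N, B, by simp,
          hw.append (List.Sublist.refl _), ?_, ?_, ?_, ?_, ?_, by simpa using hr, by simp⟩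
        · intro z hz hzr
          obtain hz | hz := List.infix_concat_iff.1 hz
          · obtain rfl | ⟨t, rfl, ht⟩ := List.suffix_concat_iff.1 hz
            · exact List.nodup_nil
            · rw [List.length_append, List.length_singleton] at hzr
              refine List.nodup_append.2 ⟨hsp t ht.isInfix (by omega), by simp, ?_⟩
              rintro y hy _ hx' rfl
              rw [List.mem_singleton] at hx'
              subst hx'
              exact hx (mem_rtake_of_suffix ht (by omega) hy)
          · exact hsp z hz hzr
        · intro p q y h
          rcases List.eq_nil_or_concat q with rfl | ⟨q, c, rfl⟩
          · rw [List.append_nil] at h ⊢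
            by_cases hyx : y = x
            · subst hyx
              have h1 : (p ++ [y]).Sublist w := by
                have : (p ++ [y] ++ [y]).Sublist (w ++ [y]) := by simpa using h
                exact List.append_sublist_append_right _ |>.1 this
              simpa using (hN y hxN p h1).append (List.Sublist.refl [y])
            · have : (p ++ [y] ++ [y]).Sublist (w ++ [x]) := by simpa using h
              have := FanSeq.sublist_of_append_right (by simpa using hyx) this
              simpa using hd' p [] y (by simpa using this)
          · have h' : (p ++ [y, y] ++ q ++ [c]).Sublist (w ++ [x]) := by simpa using h
            by_cases hcx : c = x
            · subst hcx
              have h1 := List.append_sublist_append_right _ |>.1 h'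
              simpa using (hd p q y h1).append (List.Sublist.refl [c])
            · have := FanSeq.sublist_of_append_right (by simpa using hcx) h'
              simpa using hd' p (q ++ [c]) y (by simpa using this)
        · intro y hy p h
          rw [Finset.mem_insert, not_or] at hy
          exact hN' y hy.2 p (FanSeq.sublist_of_append_right (by simpa using hy.1) h)
        · have := Finset.card_insert_le x N
          simp only [List.length_append, List.length_singleton]
          omega
        · simp only [List.length_append, List.length_singleton, List.length_nil] at hl ⊢
          have : (w.length + 1 + B) * r = (w.length + B) * r + r := by ring
          omega

/-- Tripling `a` adds no letter, so both sparsity conditions agree. Thinning an extremal sequence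
must destroy every copy of the pattern with `aa`, since such a copy would expand to one with `aaa`.
-/
theorem Ex_triple_le {α : Type*} [DecidableEq α] (p q : List α) (a : α) (n : ℕ) :
    Ex (p ++ [a, a, a] ++ q) n ≤
      (2 * Ex (p ++ [a, a] ++ q) n + 1) * numLetters (p ++ [a, a] ++ q) := by
  have hnum : numLetters (p ++ [a, a, a] ++ q) = numLetters (p ++ [a, a] ++ q) := by
    simp [numLetters]
  have hpos : 0 < numLetters (p ++ [a, a] ++ q) :=
    Finset.card_pos.2 ⟨a, by simp⟩
  obtain ⟨v, hlen, hav, hsp⟩ := (Ex_isGreatest (p ++ [a, a, a] ++ q) (by simp) n).1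
  rw [hnum] at hsp
  obtain ⟨w, -, hwsp, hle, hd⟩ := exists_thinning hpos v hsp
  rw [← hlen]
  refine hle.trans (Nat.mul_le_mul_right _ ?_)
  have := length_le_Ex (u := p ++ [a, a] ++ q) (by simp) (v := w) ?_ hwsp
  · omega
  · rintro ⟨z, hz, hi⟩
    have hz0 : z ≠ [] := by
      rintro rfl
      simpa using hi.1
    obtain ⟨f, hf, he⟩ := hi.exists_map hz0
    obtain ⟨z₁, z₃, rfl, h1, rfl⟩ := List.map_eq_append_iff.1 he.symm
    obtain ⟨z₁, z₂, rfl, rfl, h2⟩ := List.map_eq_append_iff.1 h1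
    obtain ⟨x, z₂, rfl, hx, h2⟩ := List.map_eq_cons_iff.1 h2
    obtain ⟨y, z₂, rfl, hy, h2⟩ := List.map_eq_cons_iff.1 h2
    obtain rfl := List.map_eq_nil_iff.1 h2
    obtain rfl := hf x (by simp) y (by simp) (hx.trans hy.symm)
    refine hav ⟨_, hd z₁ z₃ x hz, ?_⟩
    have := SeqIso.of_map (u := z₁ ++ [x, x, x] ++ z₃) (f := f) fun y hy z hz h =>
      hf y (by simpa using hy) z (by simpa using hz) h
    simpa [hx] using this

theorem MinimallyNonlinear.not_isBigO {α : Type*} [DecidableEq α] {u : List α}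
    (h : MinimallyNonlinear u) :
    ¬ (fun n : ℕ => (Ex u n : ℝ)) =O[Filter.atTop] (fun n : ℕ => (n : ℝ)) := by
  intro hO
  have h1 := (h.1.trans_isBigO hO).bound (c := 1 / 2) (by norm_num)
  obtain ⟨N, hN⟩ := Filter.eventually_atTop.1 h1
  have := hN (N + 1) (by omega)
  rw [Real.norm_natCast] at this
  push_cast at this
  have : (0 : ℝ) ≤ N := by positivity
  linarith

theorem MinimallyNonlinear.ne_nil {α : Type*} [DecidableEq α] {u : List α}
    (h : MinimallyNonlinear u) : u ≠ [] := by
  rintro rfl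
  refine h.not_isBigO ?_
  have : ∀ n, Ex ([] : List α) n = 0 := by
    intro n
    have : exLengths ([] : List α) n = ∅ := by
      refine Set.eq_empty_iff_forall_notMem.2 ?_
      rintro l ⟨v, -, hv, -⟩
      exact hv ⟨[], List.nil_sublist _, by simp [SeqIso]⟩
    simp [Ex, this]
  simp only [this, Nat.cast_zero]
  exact Asymptotics.isBigO_zero _ _

theorem MinimallyNonlinear.not_triple {α : Type*} [DecidableEq α] {u : List α}
    (h : MinimallyNonlinear u) (a : α) : ¬ [a, a, a] <:+: u := by
  rintro ⟨p, q, rfl⟩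
  refine h.not_isBigO ?_
  have hO := h.2 (p ++ [a, a] ++ q) ⟨_, by simp, SeqIso.refl _⟩
    (fun hi => by simpa using hi.1)
  have h1 : (fun n : ℕ => (Ex (p ++ [a, a, a] ++ q) n : ℝ)) =O[Filter.atTop]
      (fun n : ℕ => (2 * Ex (p ++ [a, a] ++ q) n + 1 : ℝ) *
        numLetters (p ++ [a, a] ++ q)) := by
    refine Asymptotics.isBigO_of_le _ fun n => ?_
    rw [Real.norm_natCast, Real.norm_of_nonneg (by positivity)]
    exact_mod_cast Ex_triple_le p q a n
  refine h1.trans ?_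
  have h2 : (fun _ : ℕ => (1 : ℝ)) =O[Filter.atTop] (fun n : ℕ => (n : ℝ)) := by
    refine Asymptotics.IsBigO.of_bound 1 (Filter.eventually_atTop.2 ⟨1, fun n hn => ?_⟩)
    simpa using hn
  simpa [mul_comm] using ((hO.const_mul_left 2).add h2).const_mul_left
    (numLetters (p ++ [a, a] ++ q) : ℝ)

theorem MinimallyNonlinear.seqIso_ababa {α : Type*} [DecidableEq α] {u : List α}
    (h : MinimallyNonlinear u) (hc : SeqContains u ababa) : SeqIso u ababa := by
  obtain ⟨w, hw, hi⟩ := hc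
  by_contra hne
  refine not_isBigO_Ex_ababa ?_
  have := h.2 w ⟨w, hw, SeqIso.refl w⟩ fun h' => hne (h'.symm.trans hi)
  simpa only [hi.Ex_eq] using this

/-! ### Counting -/

/-- The sequences over `k` letters that begin with `c` and consist of `i + 1` runs, each of length
at most two. -/
def shortRuns {k : ℕ} : ℕ → Fin k → Finset (List (Fin k))
  | 0, c => {[c], [c, c]}
  | i + 1, c => (Finset.univ.erase c).biUnion fun d =>
      (shortRuns i d).image (c :: ·) ∪ (shortRuns i d).image (c :: c :: ·)

theorem card_shortRuns_le {k : ℕ} (i : ℕ) (c : Fin k) :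
    (shortRuns i c).card ≤ 2 * (2 * k - 2) ^ i := by
  induction i generalizing c with
  | zero => exact Finset.card_le_two
  | succ i ih =>
    rw [shortRuns]
    refine (Finset.card_biUnion_le_card_mul _ _ (2 * (2 * (2 * k - 2) ^ i)) fun d _ => ?_).trans ?_
    · refine (Finset.card_union_le _ _).trans ?_
      have h1 := (Finset.card_image_le (s := shortRuns i d) (f := (c :: ·))).trans (ih d)
      have h2 := (Finset.card_image_le (s := shortRuns i d) (f := (c :: c :: ·))).trans (ih d)
      omega
    · rw [Finset.card_erase_of_mem (Finset.mem_univ c), Finset.card_univ, Fintype.card_fin,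
        show 2 * k - 2 = 2 * (k - 1) by omega, pow_succ]
      exact le_of_eq (by ring)

/-- Peel off the first run. It may have two letters, hence strong induction on the length. The
witness `c :: z` takes one letter from each run. -/
theorem exists_mem_shortRuns {k : ℕ} (u : List (Fin k)) (c : Fin k)
    (h : ∀ a, ¬ [a, a, a] <:+: c :: u) :
    ∃ i, c :: u ∈ shortRuns i c ∧
      ∃ z, (c :: z).Sublist (c :: u) ∧ (c :: z).IsChain (· ≠ ·) ∧ z.length = i := by
  induction hn : u.length using Nat.strong_induction_on generalizing u c with
  | _ n ih =>
    subst hn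
    rcases u with _ | ⟨d, u⟩
    · exact ⟨0, by simp [shortRuns], [], by simp, by simp, rfl⟩
    have h1 : ∀ a, ¬ [a, a, a] <:+: d :: u := fun a ha =>
      h a (ha.trans (List.suffix_cons _ _).isInfix)
    by_cases hcd : c = d
    · subst hcd
      rcases u with _ | ⟨d, u⟩
      · exact ⟨0, by simp [shortRuns], [], by simp, by simp, rfl⟩
      have hcd : c ≠ d := by
        rintro rfl
        exact h c ⟨[], u, by simp⟩
      obtain ⟨i, hi, z, hz, hch, hl⟩ := ih u.length (by simp) u d
        (fun a ha => h1 a (ha.trans (List.suffix_cons _ _).isInfix)) rfl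
      refine ⟨i + 1, ?_, d :: z, ?_, by simpa [hcd] using hch, by simp [hl]⟩
      · rw [shortRuns, Finset.mem_biUnion]
        exact ⟨d, by simp [hcd.symm], Finset.mem_union_right _ (Finset.mem_image_of_mem _ hi)⟩
      · exact List.Sublist.cons _ (hz.cons_cons c)
    · obtain ⟨i, hi, z, hz, hch, hl⟩ := ih u.length (by simp) u d h1 rfl
      refine ⟨i + 1, ?_, d :: z, hz.cons_cons c, by simpa [hcd] using hch, by simp [hl]⟩
      rw [shortRuns, Finset.mem_biUnion]
      exact ⟨d, by simp [Ne.symm hcd], Finset.mem_union_left _ (Finset.mem_image_of_mem _ hi)⟩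

theorem exists_mem_shortRuns_of_avoids {k : ℕ} {u : List (Fin k)} (hu : u ≠ [])
    (h : ∀ a, ¬ [a, a, a] <:+: u) (hav : ¬ SeqContains u ababa) :
    ∃ i < Ex ababa k, ∃ c, u ∈ shortRuns i c := by
  obtain ⟨c, u, rfl⟩ := List.exists_cons_of_ne_nil hu
  obtain ⟨i, hi, z, hz, hch, hl⟩ := exists_mem_shortRuns u c h
  refine ⟨i, ?_, c, hi⟩
  have := length_le_Ex (u := ababa) (by simp [ababa]) (v := c :: z)
    (fun h => hav (h.of_sublist hz))
    (by rw [numLetters_ababa]; exact isSparse_two_of_isChain hch)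
  simp only [List.length_cons] at this
  omega

theorem card_biUnion_shortRuns_le {k : ℕ} (s : Finset ℕ) :
    (s.biUnion fun i => Finset.univ.biUnion fun c : Fin k => shortRuns i c).card ≤
      2 * k * ∑ i ∈ s, (2 * k - 2) ^ i := by
  refine Finset.card_biUnion_le.trans ?_
  rw [Finset.mul_sum]
  refine Finset.sum_le_sum fun i _ => ?_
  refine (Finset.card_biUnion_le_card_mul _ _ _ fun c _ => card_shortRuns_le i c).trans ?_
  rw [Finset.card_univ, Fintype.card_fin]
  exact le_of_eq (by ring)

theorem Ex_ababa_pos {k : ℕ} (hk : 0 < k) : 0 < Ex ababa k := by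
  have := length_le_Ex (u := ababa) (by simp [ababa]) (v := [(⟨0, hk⟩ : Fin k)]) ?_
    (by rw [numLetters_ababa]; exact isSparse_two_of_isChain (by simp))
  · exact this
  · rintro ⟨w, hw, hi⟩
    have h1 := hw.length_le
    have h2 := hi.1
    simp only [ababa, List.length_cons, List.length_nil] at h1 h2
    omega

/-- All minimally non-linear sequences with `k` letters lie in an explicit finite set. -/
theorem exists_finset_minimallyNonlinear (k : ℕ) :
    ∃ F : Finset (List (Fin k)), {u : List (Fin k) | numLetters u = k ∧ MinimallyNonlinear u} ⊆ F ∧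
      F.card ≤ 2 * k * ∑ i ∈ Finset.range (Ex ababa k), (2 * k - 2) ^ i := by
  -- Only for `k = 2` can `u` be a copy of `ababa`. At most four such sequences are added, and the
  -- four units of the term `i = 0` pay for them, since a single run cannot use two letters.
  by_cases hk : k = 2
  · subst hk
    obtain ⟨L, hL⟩ : ∃ L, Ex ababa 2 = L + 1 :=
      ⟨Ex ababa 2 - 1, by have := Ex_ababa_pos (k := 2) (by norm_num); omega⟩
    refine ⟨(Finset.univ.image fun p : Fin 2 × Fin 2 => [p.1, p.2, p.1, p.2, p.1]) ∪
      (Finset.Icc 1 L).biUnion fun i => Finset.univ.biUnion fun c : Fin 2 => shortRuns i c, ?_, ?_⟩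
    · rintro u ⟨hnum, hu⟩
      rw [Finset.mem_coe, Finset.mem_union]
      by_cases hc : SeqContains u ababa
      · left
        obtain ⟨f, -, rfl⟩ := (hu.seqIso_ababa hc).symm.exists_map (by simp [ababa])
        exact Finset.mem_image.2 ⟨(f 0, f 1), Finset.mem_univ _, by simp [ababa]⟩
      · right
        obtain ⟨i, hi, c, hm⟩ := exists_mem_shortRuns_of_avoids hu.ne_nil hu.not_triple hc
        refine Finset.mem_biUnion.2 ⟨i, Finset.mem_Icc.2 ⟨?_, by omega⟩,
          Finset.mem_biUnion.2 ⟨c, Finset.mem_univ _, hm⟩⟩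
        by_contra! hi0
        obtain rfl : i = 0 := by omega
        simp only [shortRuns, Finset.mem_insert, Finset.mem_singleton] at hm
        rcases hm with rfl | rfl <;> simp [numLetters] at hnum
    · refine (Finset.card_union_le _ _).trans ?_
      have h1 : (Finset.univ.image fun p : Fin 2 × Fin 2 => [p.1, p.2, p.1, p.2, p.1]).card ≤ 4 :=
        Finset.card_image_le
      have h2 := card_biUnion_shortRuns_le (k := 2) (Finset.Icc 1 L)
      have h3 : ∑ i ∈ Finset.range (L + 1), (2 * 2 - 2) ^ i =
          1 + ∑ i ∈ Finset.Icc 1 L, (2 * 2 - 2) ^ i := by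
        rw [Finset.range_eq_Ico, Finset.sum_eq_sum_Ico_succ_bot (by omega)]
        rfl
      rw [hL, h3]
      omega
  · refine ⟨_, ?_, card_biUnion_shortRuns_le _⟩
    rintro u ⟨hnum, hu⟩
    have hc : ¬ SeqContains u ababa := fun hc => hk <| by
      rw [← hnum, (hu.seqIso_ababa hc).numLetters_eq, numLetters_ababa]
    obtain ⟨i, hi, c, hm⟩ := exists_mem_shortRuns_of_avoids hu.ne_nil hu.not_triple hc
    exact Finset.mem_biUnion.2 ⟨i, Finset.mem_range.2 hi,
      Finset.mem_biUnion.2 ⟨c, Finset.mem_univ _, hm⟩⟩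

theorem mainTheorem11 (k : ℕ) :
    {u : List (Fin k) | numLetters u = k ∧ MinimallyNonlinear u}.Finite ∧
    {u : List (Fin k) | numLetters u = k ∧ MinimallyNonlinear u}.ncard ≤
      2 * k * ∑ i ∈ Finset.Icc 1 (Ex ababa k), (2 * k - 2) ^ (i - 1) := by
  obtain ⟨F, hF, hcard⟩ := exists_finset_minimallyNonlinear k
  refine ⟨F.finite_toSet.subset hF, ?_⟩
  have hsum : ∑ i ∈ Finset.Icc 1 (Ex ababa k), (2 * k - 2) ^ (i - 1) =
      ∑ i ∈ Finset.range (Ex ababa k), (2 * k - 2) ^ i := by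
    rw [Finset.range_eq_Ico, Finset.sum_Ico_eq_sum_range, ← Finset.Ico_add_one_right_eq_Icc,
      Finset.sum_Ico_eq_sum_range]
    simp
  rw [hsum]
  exact ((Set.ncard_le_ncard hF F.finite_toSet).trans (Set.ncard_coe_finset F).le).trans hcard
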